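/- Let $\Lambda_\oplus$ be the untyped probabilistic $\lambda$-calculus $M,N ::= x \mid \lambda x.M \mid MN \mid M\oplus N$ (terms up to $\alpha$-equivalence), and for a closed term $M$ let $[\![M]\!]$ be its call-by-name semantics, i.e. the supremum of the finite-support distributions $\mathscr D$ on values (closed abstractions) derivable by the rules: $M\Downarrow\emptyset$; $V\Downarrow\{V\}$ for a value $V$; if $M\Downarrow\mathscr D$ and $P[N/x]\Downarrow\mathscr E_{P}$ for all $\lambda x.P\in\mathrm{supp}(\mathscr D)$, then $MN\Downarrow\sum_{\lambda x.P\in\mathrm{supp}(\mathscr D)}\mathscr D(\lambda x.P)\,\mathscr E_P$; if $M\Downarrow\mathscr D$ and $N\Downarrow\mathscr E$, then $M\oplus N\Downarrow\frac12\mathscr D+\frac12\mathscr E$. Terms $M,N$ are context equivalent, $M\simeq_\oplus N$, if $\sum_V[\![C[M]]\!](V)=\sum_V[\![C[N]]\!](V)$ for every closing one-hole $\Lambda_\oplus$-context $C$. A formal sum $\coprod_{i\in I}\langle M_i,p_i\rangle$ is a countable, possibly empty, family of closed $\Lambda_\oplus$-terms $M_i$ with weights $p_i\ge 0$ such that $\sum_i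 p_i\le 1$; it is a (formally summed) value if every $M_i$ is an abstraction. The closed terms of $\Lambda_\oplus^{\mathrm{FS}}$ are $E ::= EM \mid \coprod_{i\in I}\langle M_i,p_i\rangle \mid M\oplus N \mid \lambda x.M$, where $M,N$ are closed $\Lambda_\oplus$-terms (in $\lambda x.M$ the variable $x$ may be free in $M$). Thus every closed $\Lambda_\oplus$-term is a closed $\Lambda_\oplus^{\mathrm{FS}}$-term. For a formally summed value $Z=\coprod_i\langle\lambda x.M_i,p_i\rangle$ put $\mathrm{prob}(Z)=\sum_i p_i$ and $Z\bullet N=\coprod_i\langle M_i[N/x],p_i\rangle$. Reduction $\leadsto$ is generated by $M\oplus N\leadsto\langle M,\frac12\rangle+\langle N,\frac12\rangle$; $\lambda x.M\leadsto\langle\lambda x.M,1\rangle$; $\coprod_i\langle M_i,p_i\rangle\leadsto\coprod_{i,V}\langle V,[\![M_i]\!](V)\cdot p_i\rangle$ if some $M_i$ is not a value; $ZM\leadsto Z\bullet M$ for a formally summed value $Z$; and $EM\leadsto FM$ whenever $E\leadsto F$. Let $\Rightarrow$ be its reflexive transitive closure, and write $E\Downarrow p$ if $E\Rightarrow Z$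 for a formally summed value $Z$ with $\mathrm{prob}(Z)=p$. Write $M\simeq_\oplus^{\mathrm{FS}}N$ if for every closing one-hole $\Lambda_\oplus$-context $C$ and every $p$, $C[M]\Downarrow p$ iff $C[N]\Downarrow p$. For closed $\Lambda_\oplus^{\mathrm{FS}}$-terms $E,F$ write $E\approxeq_\oplus^{\mathrm{FS}}F$ (evaluation-context equivalence) if for all closed $\Lambda_\oplus$-terms $M_1,\dots,M_k$ ($k\ge 0$) and every $p$, $EM_1\cdots M_k\Downarrow p$ iff $FM_1\cdots M_k\Downarrow p$. A coupled logical bisimulation is a pair $(\mathcal R_1,\mathcal R_2)$ of relations, $\mathcal R_1$ on closed $\Lambda_\oplus$-terms and $\mathcal R_2$ on closed $\Lambda_\oplus^{\mathrm{FS}}$-terms, with $\mathcal R_1\subseteq\mathcal R_2$, such that whenever $E\,\mathcal R_2\,F$: (1) if $E\leadsto D$, then $F\Rightarrow G$ for some $G$ with $D\,\mathcal R_2\,G$; (2) if $E$ is a formally summed value, then $F\Rightarrow Y$ for a formally summed value $Y$ with $\mathrm{prob}(E)=\mathrm{prob}(Y)$ and $(E\bullet M)\,\mathcal R_2\,(Y\bullet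 N)$ for all closed $M,N$ related by the closure of $\mathcal R_1$ under multi-hole $\Lambda_\oplus$-contexts; (3) the converses of (1) and (2), with the roles of $E$ and $F$ exchanged. Coupled logical bisimilarity $\approx\,=(\approx_1,\approx_2)$ is the componentwise union of all coupled logical bisimulations. Then: (a) for all closed $\Lambda_\oplus$-terms $M,N$: $M\approx_1N$ iff $M\simeq_\oplus^{\mathrm{FS}}N$ iff $M\simeq_\oplus N$; (b) for all closed $\Lambda_\oplus^{\mathrm{FS}}$-terms $E,F$: $E\approx_2F$ iff $E\approxeq_\oplus^{\mathrm{FS}}F$; (c) for all $\Lambda_\oplus$-terms $M,N$ with free variables among $x_1,\dots,x_n$: $M\simeq_\oplus^{\mathrm{FS}}N$ iff $M\simeq_\oplus N$ (the contexts capturing $x_1,\dots,x_n$), and this holds iff $M[L_1/x_1,\dots,L_n/x_n]\approx_1N[L_1/x_1,\dots,L_n/x_n]$ for all closed $\Lambda_\oplus$-terms $L_1,\dots,L_n$. -/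

import Mathlib

open scoped ENNReal

namespace ProbLam

/-! ### The probabilistic lambda-calculus -/

/-- Terms of the calculus whose free variables are among `n` given ones (up to renaming of bound
variables: de Bruijn indices). `Tm 0` is the set of closed terms. -/
inductive Tm : ℕ → Type
  | var {n : ℕ} (i : Fin n) : Tm n
  | lam {n : ℕ} (M : Tm (n + 1)) : Tm n
  | app {n : ℕ} (M N : Tm n) : Tm n
  | choice {n : ℕ} (M N : Tm n) : Tm n

/-- A renaming, extended under one binder. -/
def liftRen {m n : ℕ} (ρ : Fin m → Fin n) : Fin (m + 1) → Fin (n + 1) :=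
  Fin.cases 0 (fun i => (ρ i).succ)

/-- Renaming of free variables. -/
def Tm.rename : {m n : ℕ} → (Fin m → Fin n) → Tm m → Tm n
  | _, _, ρ, .var i => .var (ρ i)
  | _, _, ρ, .lam M => .lam (M.rename (liftRen ρ))
  | _, _, ρ, .app M N => .app (M.rename ρ) (N.rename ρ)
  | _, _, ρ, .choice M N => .choice (M.rename ρ) (N.rename ρ)

/-- A substitution, extended under one binder. -/
def liftSub {m n : ℕ} (σ : Fin m → Tm n) : Fin (m + 1) → Tm (n + 1) :=
  Fin.cases (.var 0) (fun i => (σ i).rename Fin.succ)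

/-- Simultaneous capture-avoiding substitution. -/
def Tm.subst : {m n : ℕ} → (Fin m → Tm n) → Tm m → Tm n
  | _, _, σ, .var i => σ i
  | _, _, σ, .lam M => .lam (M.subst (liftSub σ))
  | _, _, σ, .app M N => .app (M.subst σ) (N.subst σ)
  | _, _, σ, .choice M N => .choice (M.subst σ) (N.subst σ)

/-- `P[N/x]`, where `x` is the only variable that may be free in `P`, and `N` is closed. -/
def Tm.inst (P : Tm 1) (N : Tm 0) : Tm 0 := P.subst (fun _ => N)

/-- A closed term seen as a term in a larger scope. -/
def Tm.weaken {n : ℕ} (M : Tm 0) : Tm n := M.rename Fin.elim0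

/-- Lambda-abstractions; the closed ones are the values. -/
def Tm.IsLam {n : ℕ} (M : Tm n) : Prop := ∃ P : Tm (n + 1), M = .lam P

/-- A numbering of terms, used only to see that there are countably many of them. -/
def Tm.code : {n : ℕ} → Tm n → ℕ
  | _, .var i => Nat.pair 0 i.val
  | _, .lam M => Nat.pair 1 M.code
  | _, .app M N => Nat.pair 2 (Nat.pair M.code N.code)
  | _, .choice M N => Nat.pair 3 (Nat.pair M.code N.code)

theorem Tm.code_injective {n : ℕ} (M N : Tm n) (h : M.code = N.code) : M = N := by
  induction M with
  | var i => cases N <;> simp_all [Tm.code, Fin.ext_iff]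
  | lam M ih =>
    cases N <;> simp only [Tm.code, Nat.pair_eq_pair] at h <;> first | omega | skip
    rw [ih _ h.2]
  | app M M' ih ih' =>
    cases N <;> simp only [Tm.code, Nat.pair_eq_pair] at h <;> first | omega | skip
    rw [ih _ h.2.1, ih' _ h.2.2]
  | choice M M' ih ih' =>
    cases N <;> simp only [Tm.code, Nat.pair_eq_pair] at h <;> first | omega | skip
    rw [ih _ h.2.1, ih' _ h.2.2]

instance {n : ℕ} : Countable (Tm n) := ⟨Tm.code, fun M N h => Tm.code_injective M N h⟩

/-! ### Call-by-name semantics -/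

/-- Big-step approximation semantics. A value, being a closed abstraction `λx.P`, is represented
by its body `P : Tm 1`; distributions on values with finite support are finitely supported
functions on `Tm 1`. -/
inductive BigStep : Tm 0 → (Tm 1 →₀ ℝ≥0∞) → Prop
  | bt (M : Tm 0) : BigStep M 0
  | bv (P : Tm 1) : BigStep (.lam P) (Finsupp.single P 1)
  | ba (M N : Tm 0) (D : Tm 1 →₀ ℝ≥0∞) (E : Tm 1 → (Tm 1 →₀ ℝ≥0∞)) :
      BigStep M D → (∀ P ∈ D.support, BigStep (P.inst N) (E P)) →
      BigStep (.app M N) (∑ P ∈ D.support, D P • E P)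
  | bs (M N : Tm 0) (D E : Tm 1 →₀ ℝ≥0∞) :
      BigStep M D → BigStep N E →
      BigStep (.choice M N) ((2⁻¹ : ℝ≥0∞) • D + (2⁻¹ : ℝ≥0∞) • E)

/-- The semantics `⟦M⟧` of a closed term: the (pointwise) supremum of its approximations. -/
noncomputable def sem (M : Tm 0) (V : Tm 1) : ℝ≥0∞ :=
  ⨆ D : {D : Tm 1 →₀ ℝ≥0∞ // BigStep M D}, D.1 V

/-- `M` converges with probability `p`. -/
def ConvergesTo (M : Tm 0) (p : ℝ≥0∞) : Prop := ∑' V, sem M V = p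

/-- The approximations of a term have total mass at most one. -/
theorem BigStep.mass_le_one {M : Tm 0} {D : Tm 1 →₀ ℝ≥0∞} (h : BigStep M D) :
    ∑' V, D V ≤ 1 := by
  induction h with
  | bt M => simp
  | bv P => rw [tsum_eq_single P] <;> simp +contextual [eq_comm]
  | ba M N D E _ _ ih ih' =>
    simp only [Finsupp.coe_finsetSum, Finset.sum_apply, Finsupp.smul_apply, smul_eq_mul]
    rw [Summable.tsum_finsetSum (fun _ _ => ENNReal.summable)]
    calc ∑ P ∈ D.support, ∑' V, D P * E P V
        ≤ ∑ P ∈ D.support, D P := by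
          refine Finset.sum_le_sum fun P hP => ?_
          rw [ENNReal.tsum_mul_left]
          exact mul_le_of_le_one_right' (ih' P hP)
      _ ≤ ∑' V, D V := ENNReal.sum_le_tsum _
      _ ≤ 1 := ih
  | bs M N D E _ _ ih ih' =>
    simp only [Finsupp.add_apply, Finsupp.smul_apply, smul_eq_mul]
    rw [ENNReal.tsum_add, ENNReal.tsum_mul_left, ENNReal.tsum_mul_left]
    calc _ ≤ (2⁻¹ : ℝ≥0∞) * 1 + 2⁻¹ * 1 := by gcongr
      _ = 1 := by simp [ENNReal.inv_two_add_inv_two]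

/-- The approximations of a term form a directed set. -/
theorem BigStep.directed {M : Tm 0} {D₁ D₂ : Tm 1 →₀ ℝ≥0∞} (h₁ : BigStep M D₁)
    (h₂ : BigStep M D₂) : ∃ D, BigStep M D ∧ (∀ V, D₁ V ≤ D V) ∧ (∀ V, D₂ V ≤ D V) := by
  induction h₁ generalizing D₂ with
  | bt M => exact ⟨D₂, h₂, by simp, fun _ => le_rfl⟩
  | bv P =>
    cases h₂ with
    | bt => exact ⟨_, .bv P, fun _ => le_rfl, by simp⟩
    | bv => exact ⟨_, .bv P, fun _ => le_rfl, fun _ => le_rfl⟩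
  | ba M N D E hM hE ih ih' =>
    cases h₂ with
    | bt => exact ⟨_, .ba M N D E hM hE, fun _ => le_rfl, by simp⟩
    | ba _ _ D' E' hM' hE' =>
      obtain ⟨D'', hD'', hl, hr⟩ := ih hM'
      have key : ∀ P, ∃ F, BigStep (P.inst N) F ∧ (P ∈ D.support → ∀ V, E P V ≤ F V) ∧
          (P ∈ D'.support → ∀ V, E' P V ≤ F V) := by
        intro P
        by_cases hP : P ∈ D.support
        · by_cases hP' : P ∈ D'.support
          · obtain ⟨F, hF, h1, h2⟩ := ih' P hP (hE' P hP')
            exact ⟨F, hF, fun _ => h1, fun _ => h2⟩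
          · exact ⟨E P, hE P hP, fun _ _ => le_rfl, fun h => absurd h hP'⟩
        · by_cases hP' : P ∈ D'.support
          · exact ⟨E' P, hE' P hP', fun h => absurd h hP, fun _ _ => le_rfl⟩
          · exact ⟨0, .bt _, fun h => absurd h hP, fun h => absurd h hP'⟩
      choose F hF h1 h2 using key
      have sub : ∀ {G G' : Tm 1 →₀ ℝ≥0∞}, (∀ V, G V ≤ G' V) → G.support ⊆ G'.support := by
        intro G G' h V hV
        rw [Finsupp.mem_support_iff] at hV ⊢
        exact fun h0 => hV (le_antisymm (h0 ▸ h V) bot_le)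
      refine ⟨_, .ba M N D'' F hD'' (fun P _ => hF P), fun V => ?_, fun V => ?_⟩ <;>
        simp only [Finsupp.coe_finsetSum, Finset.sum_apply, Finsupp.smul_apply, smul_eq_mul]
      · refine (Finset.sum_le_sum fun P hP => ?_).trans
          (Finset.sum_le_sum_of_subset (f := fun P => D'' P * F P V) (sub hl))
        exact mul_le_mul' (hl P) (h1 P hP V)
      · refine (Finset.sum_le_sum fun P hP => ?_).trans
          (Finset.sum_le_sum_of_subset (f := fun P => D'' P * F P V) (sub hr))
        exact mul_le_mul' (hr P) (h2 P hP V)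
  | bs M N D E hM hN ih ih' =>
    cases h₂ with
    | bt => exact ⟨_, .bs M N D E hM hN, fun _ => le_rfl, by simp⟩
    | bs _ _ D' E' hM' hN' =>
      obtain ⟨D'', hD, hl, hr⟩ := ih hM'
      obtain ⟨E'', hE, kl, kr⟩ := ih' hN'
      refine ⟨_, .bs M N D'' E'' hD hE, fun V => ?_, fun V => ?_⟩ <;>
        simp only [Finsupp.add_apply, Finsupp.smul_apply, smul_eq_mul]
      · exact add_le_add (mul_le_mul' le_rfl (hl V)) (mul_le_mul' le_rfl (kl V))
      · exact add_le_add (mul_le_mul' le_rfl (hr V)) (mul_le_mul' le_rfl (kr V))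

/-- The semantics of a term is a (partial) value distribution. -/
theorem sem_mass_le_one (M : Tm 0) : ∑' V, sem M V ≤ 1 := by
  rw [ENNReal.tsum_eq_iSup_sum]
  refine iSup_le fun s => ?_
  unfold sem
  rw [ENNReal.finsetSum_iSup]
  · refine iSup_le fun D => (ENNReal.sum_le_tsum s).trans D.2.mass_le_one
  · intro D₁ D₂
    obtain ⟨D, hD, h1, h2⟩ := D₁.2.directed D₂.2
    exact ⟨⟨D, hD⟩, fun V => ⟨h1 V, h2 V⟩⟩

/-! ### Contexts and context equivalence -/

/-- One-hole contexts. `Ctx m n` holds the contexts with free variables among `n` given ones and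
with a hole for terms with free variables among `m` given ones, which may be captured: the
embedding `ρ` at the hole says what each of these `m` variables refers to at that place. -/
inductive Ctx (m : ℕ) : ℕ → Type
  | hole {n : ℕ} (ρ : Fin m ↪ Fin n) : Ctx m n
  | lam {n : ℕ} (C : Ctx m (n + 1)) : Ctx m n
  | appL {n : ℕ} (C : Ctx m n) (M : Tm n) : Ctx m n
  | appR {n : ℕ} (M : Tm n) (C : Ctx m n) : Ctx m n
  | choiceL {n : ℕ} (C : Ctx m n) (M : Tm n) : Ctx m n
  | choiceR {n : ℕ} (M : Tm n) (C : Ctx m n) : Ctx m n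

/-- `C[L]`: the hole of `C` filled with `L`. -/
def Ctx.fill {m : ℕ} (L : Tm m) : {n : ℕ} → Ctx m n → Tm n
  | _, .hole ρ => L.rename ρ
  | _, .lam C => .lam (C.fill L)
  | _, .appL C M => .app (C.fill L) M
  | _, .appR M C => .app M (C.fill L)
  | _, .choiceL C M => .choice (C.fill L) M
  | _, .choiceR M C => .choice M (C.fill L)

/-- The context preorder. -/
def CtxLe {n : ℕ} (M N : Tm n) : Prop :=
  ∀ (C : Ctx n 0) (p : ℝ≥0∞), ConvergesTo (C.fill M) p → ∃ q, ConvergesTo (C.fill N) q ∧ p ≤ q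

/-- Context equivalence of the probabilistic lambda-calculus. -/
def CtxEquiv {n : ℕ} (M N : Tm n) : Prop := CtxLe M N ∧ CtxLe N M

/-- Closure of a relation on closed terms under multi-hole contexts: the pairs `(C[M₁,…,Mₖ],
C[N₁,…,Nₖ])` with `Mᵢ` related to `Nᵢ`, by recursion on `C`. The closed pairs in it are those
with `n = 0`. -/
inductive CtxClosure (R : Tm 0 → Tm 0 → Prop) : {n : ℕ} → Tm n → Tm n → Prop
  | hole {n : ℕ} {M N : Tm 0} : R M N → CtxClosure R (M.weaken : Tm n) N.weaken
  | var {n : ℕ} (i : Fin n) : CtxClosure R (.var i) (.var i)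
  | lam {n : ℕ} {M N : Tm (n + 1)} : CtxClosure R M N → CtxClosure R (.lam M) (.lam N)
  | app {n : ℕ} {M N M' N' : Tm n} : CtxClosure R M N → CtxClosure R M' N' →
      CtxClosure R (.app M M') (.app N N')
  | choice {n : ℕ} {M N M' N' : Tm n} : CtxClosure R M N → CtxClosure R M' N' →
      CtxClosure R (.choice M M') (.choice N N')

/-! ### Formal sums -/

/-- Formal weighted sums `∐_{i ∈ I} ⟨Mᵢ, pᵢ⟩` of closed terms, `I` countable and `∑ pᵢ ≤ 1`. -/
structure FSum : Type 1 where
  I : Type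
  countable : Countable I
  term : I → Tm 0
  wt : I → ℝ≥0∞
  wt_le : ∑' i, wt i ≤ 1

namespace FSum

/-- The total weight of a formal sum. -/
noncomputable def prob (H : FSum) : ℝ≥0∞ := ∑' i, H.wt i

/-- Formally summed values. -/
def IsValue (H : FSum) : Prop := ∀ i, (H.term i).IsLam

/-- `⟨M, 1⟩`. -/
def single (M : Tm 0) : FSum where
  I := Unit
  countable := inferInstance
  term _ := M
  wt _ := 1
  wt_le := by simp

/-- `⟨M, 1/2⟩ + ⟨N, 1/2⟩`. -/
noncomputable def half (M N : Tm 0) : FSum where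
  I := Bool
  countable := inferInstance
  term b := cond b M N
  wt _ := 2⁻¹
  wt_le := by simp [tsum_fintype, ← two_mul, ENNReal.mul_inv_cancel]

/-- The distribution `⟦M⟧` as the formal sum `∐_V ⟨V, ⟦M⟧(V)⟩` over all values `V`. -/
noncomputable def ofSem (M : Tm 0) : FSum where
  I := Tm 1
  countable := inferInstance
  term P := .lam P
  wt P := sem M P
  wt_le := sem_mass_le_one M

/-- For `H = ∐ᵢ ⟨Mᵢ, pᵢ⟩`, the flattened formal sum `∐ᵢ ⟨K Mᵢ, pᵢ⟩ = ∐_{i,j} ⟨Nᵢⱼ, qᵢⱼ · pᵢ⟩`, where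
`K Mᵢ = ∐ⱼ ⟨Nᵢⱼ, qᵢⱼ⟩`. -/
noncomputable def bind (H : FSum) (K : Tm 0 → FSum) : FSum where
  I := Σ i : H.I, (K (H.term i)).I
  countable :=
    haveI := H.countable
    haveI : ∀ i : H.I, Countable (K (H.term i)).I := fun i => (K (H.term i)).countable
    inferInstance
  term x := (K (H.term x.1)).term x.2
  wt x := (K (H.term x.1)).wt x.2 * H.wt x.1
  wt_le := by
    rw [ENNReal.tsum_sigma (fun i j => (K (H.term i)).wt j * H.wt i)]
    refine le_trans (ENNReal.tsum_le_tsum fun i => ?_) H.wt_le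
    rw [ENNReal.tsum_mul_right]
    exact mul_le_of_le_one_left' (K (H.term i)).wt_le

/-- `P[N/x]` for a value `λx.P`. Closed terms that are not values are left alone; this case is
never used. -/
def contract (N : Tm 0) : Tm 0 → Tm 0
  | .lam P => P.inst N
  | .app M M' => .app M M'
  | .choice M M' => .choice M M'

/-- `Z • N = ∐ᵢ ⟨Pᵢ[N/x], pᵢ⟩`, for a formally summed value `Z = ∐ᵢ ⟨λx.Pᵢ, pᵢ⟩`. -/
def bullet (Z : FSum) (N : Tm 0) : FSum where
  I := Z.I
  countable := Z.countable
  term i := contract N (Z.term i)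
  wt := Z.wt
  wt_le := Z.wt_le

end FSum

/-! ### The calculus with formal sums in redex position -/

/-- Closed terms of the calculus with formal sums. -/
inductive FTm : Type 1
  | app (E : FTm) (M : Tm 0) : FTm
  | sum (H : FSum) : FTm
  | choice (M N : Tm 0) : FTm
  | lam (M : Tm 1) : FTm

/-- Closed terms of the probabilistic lambda-calculus as terms of the calculus with formal sums. -/
def Tm.toFTm : Tm 0 → FTm
  | .lam P => .lam P
  | .app M N => .app M.toFTm N
  | .choice M N => .choice M N

/-- One step of reduction between terms with formal sums. -/
inductive Step : FTm → FTm → Prop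
  | ss (M N : Tm 0) : Step (.choice M N) (.sum (FSum.half M N))
  | sl (P : Tm 1) : Step (.lam P) (.sum (FSum.single (.lam P)))
  | spc (H : FSum) : ¬ H.IsValue → Step (.sum H) (.sum (H.bind FSum.ofSem))
  | sp (Z : FSum) (M : Tm 0) : Z.IsValue → Step (.app (.sum Z) M) (.sum (Z.bullet M))
  | sa (E F : FTm) (M : Tm 0) : Step E F → Step (.app E M) (.app F M)

/-- Reduction in any number of steps. -/
def Steps : FTm → FTm → Prop := Relation.ReflTransGen Step

/-- `E` reduces to a formally summed value of total weight `p`. -/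
def FTm.ConvergesTo (E : FTm) (p : ℝ≥0∞) : Prop :=
  ∃ Z : FSum, Z.IsValue ∧ Steps E (.sum Z) ∧ Z.prob = p

/-- The term `E M₁ ⋯ Mₖ`, that is, `E` in the evaluation context `[·] M₁ ⋯ Mₖ`. -/
def FTm.apps (E : FTm) (Ms : List (Tm 0)) : FTm := Ms.foldl FTm.app E

/-- Context equivalence in the calculus with formal sums (contexts have no formal sums). -/
def CtxEquivFS {n : ℕ} (M N : Tm n) : Prop :=
  ∀ (C : Ctx n 0) (p : ℝ≥0∞),
    (C.fill M).toFTm.ConvergesTo p ↔ (C.fill N).toFTm.ConvergesTo p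

/-- Evaluation-context equivalence. -/
def EvalCtxEquiv (E F : FTm) : Prop :=
  ∀ (Ms : List (Tm 0)) (p : ℝ≥0∞), (E.apps Ms).ConvergesTo p ↔ (F.apps Ms).ConvergesTo p

/-! ### Coupled logical bisimilarity -/

/-- `(R₁, R₂)` is a coupled logical bisimulation. -/
structure IsCoupledLogicalBisimulation (R₁ : Tm 0 → Tm 0 → Prop) (R₂ : FTm → FTm → Prop) :
    Prop where
  coupled : ∀ M N, R₁ M N → R₂ M.toFTm N.toFTm
  step : ∀ E F, R₂ E F → ∀ D, Step E D → ∃ G, Steps F G ∧ R₂ D G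
  value : ∀ (Z : FSum) (F : FTm), R₂ (.sum Z) F → Z.IsValue →
    ∃ Y : FSum, Y.IsValue ∧ Steps F (.sum Y) ∧ Z.prob = Y.prob ∧
      ∀ M N : Tm 0, CtxClosure R₁ M N → R₂ (.sum (Z.bullet M)) (.sum (Y.bullet N))
  step_conv : ∀ E F, R₂ E F → ∀ G, Step F G → ∃ D, Steps E D ∧ R₂ D G
  value_conv : ∀ (E : FTm) (Y : FSum), R₂ E (.sum Y) → Y.IsValue →
    ∃ Z : FSum, Z.IsValue ∧ Steps E (.sum Z) ∧ Z.prob = Y.prob ∧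
      ∀ M N : Tm 0, CtxClosure R₁ M N → R₂ (.sum (Z.bullet M)) (.sum (Y.bullet N))

/-- The first component of coupled logical bisimilarity. -/
def Bisimilar₁ (M N : Tm 0) : Prop :=
  ∃ R₁ R₂, IsCoupledLogicalBisimulation R₁ R₂ ∧ R₁ M N

/-- The second component of coupled logical bisimilarity. -/
def Bisimilar₂ (E F : FTm) : Prop :=
  ∃ R₁ R₂, IsCoupledLogicalBisimulation R₁ R₂ ∧ R₂ E F

/-- The extension of the first component to open terms, through all closing substitutions. -/
def Bisimilar₁Open {n : ℕ} (M N : Tm n) : Prop :=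
  ∀ σ : Fin n → Tm 0, Bisimilar₁ (M.subst σ) (N.subst σ)

end ProbLam

namespace ProbLam

/-! ### Renaming and substitution -/

/-! Every relation in the theorem is compared with one quantity, `mass M S`: the probability that
`M` converges on the stack of arguments `S`. On closed terms each of them says that the masses agree
on all stacks; on open terms, that they do so under all closing substitutions (`MassEquiv`).

The crux is that `MassEquiv` is a congruence. As in Howe's method, it is enlarged to `MassClosure`,
which is compatible and substitutive by construction. Related terms on related stacks are then shown
to satisfy an inequality of masses (`MassClosure.massWithin_le`), by induction on a step bound for
the left term, the right one being left unbounded. Congruence gives context equivalence. Conversely,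
β-redexes and applications turn substitutions and stacks into contexts (`massEquiv_iff_ctxEquiv`).

For formal sums, reduction preserves mass (`Step.mass_eq`) and every term reaches a formally summed
value, so converging to `p` means having mass `p` on the empty stack. A coupled logical bisimulation
therefore preserves mass, by induction on the stack. Equality of masses is itself such a
bisimulation, congruence supplying the clause about related arguments. -/

theorem liftSub_var_comp {m n : ℕ} (ρ : Fin m → Fin n) :
    liftSub (fun i => Tm.var (ρ i)) = fun i => Tm.var (liftRen ρ i) := by
  funext i
  refine Fin.cases ?_ (fun i => ?_) i <;> simp [liftSub, liftRen, Tm.rename]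

theorem Tm.rename_eq_subst {m n : ℕ} (M : Tm m) (ρ : Fin m → Fin n) :
    M.rename ρ = M.subst (fun i => .var (ρ i)) := by
  induction M generalizing n with
  | var i => rfl
  | lam M ih => simp [Tm.rename, Tm.subst, ih, liftSub_var_comp]
  | app M N ih ih' => simp [Tm.rename, Tm.subst, ih, ih']
  | choice M N ih ih' => simp [Tm.rename, Tm.subst, ih, ih']

theorem Tm.subst_rename {m n k : ℕ} (M : Tm m) (ρ : Fin m → Fin n) (σ : Fin n → Tm k) :
    (M.rename ρ).subst σ = M.subst (fun i => σ (ρ i)) := by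
  induction M generalizing n k with
  | var i => rfl
  | lam M ih =>
    simp only [Tm.rename, Tm.subst, ih]
    congr 2
    funext i
    refine Fin.cases ?_ (fun i => ?_) i <;> simp [liftSub, liftRen]
  | app M N ih ih' => simp [Tm.rename, Tm.subst, ih, ih']
  | choice M N ih ih' => simp [Tm.rename, Tm.subst, ih, ih']

theorem Tm.rename_subst {m n k : ℕ} (M : Tm m) (σ : Fin m → Tm n) (ρ : Fin n → Fin k) :
    (M.subst σ).rename ρ = M.subst (fun i => (σ i).rename ρ) := by
  induction M generalizing n k with
  | var i => rfl
  | lam M ih =>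
    simp only [Tm.rename, Tm.subst, ih]
    congr 2
    funext i
    refine Fin.cases ?_ (fun i => ?_) i
    · simp [liftSub, liftRen, Tm.rename]
    · simp only [liftSub, Fin.cases_succ]
      -- Both sides are composites of two renamings; reading the outer one as a substitution reduces
      -- them to `Tm.subst_rename`.
      rw [Tm.rename_eq_subst _ (liftRen ρ), Tm.subst_rename, Tm.rename_eq_subst _ Fin.succ,
        Tm.subst_rename]
      simp [liftRen]
  | app M N ih ih' => simp [Tm.rename, Tm.subst, ih, ih']
  | choice M N ih ih' => simp [Tm.rename, Tm.subst, ih, ih']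

theorem Tm.subst_subst {m n k : ℕ} (M : Tm m) (σ : Fin m → Tm n) (τ : Fin n → Tm k) :
    (M.subst σ).subst τ = M.subst (fun i => (σ i).subst τ) := by
  induction M generalizing n k with
  | var i => rfl
  | lam M ih =>
    simp only [Tm.subst, ih]
    congr 2
    funext i
    refine Fin.cases ?_ (fun i => ?_) i
    · simp [liftSub, Tm.subst]
    · simp [liftSub, Tm.subst_rename, Tm.rename_subst]
  | app M N ih ih' => simp [Tm.subst, ih, ih']
  | choice M N ih ih' => simp [Tm.subst, ih, ih']

theorem Tm.subst_var {m : ℕ} (M : Tm m) : M.subst .var = M := by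
  induction M with
  | var i => rfl
  | @lam n M ih =>
    have h : liftSub (Tm.var (n := n)) = .var := by
      funext i
      refine Fin.cases ?_ (fun i => ?_) i <;> simp [liftSub, Tm.rename]
    rw [Tm.subst, h, ih]
  | app M N ih ih' => simp [Tm.subst, ih, ih']
  | choice M N ih ih' => simp [Tm.subst, ih, ih']

theorem Tm.subst_closed (M : Tm 0) (σ : Fin 0 → Tm 0) : M.subst σ = M := by
  rw [Subsingleton.elim σ .var, M.subst_var]

theorem Tm.weaken_subst {n : ℕ} (M : Tm 0) (σ : Fin n → Tm 0) :
    (M.weaken : Tm n).subst σ = M := by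
  rw [Tm.weaken, Tm.subst_rename, M.subst_closed]

/-- Substituting under a binder and then for the bound variable is one substitution. -/
theorem Tm.inst_subst_liftSub {n : ℕ} (M : Tm (n + 1)) (σ : Fin (n + 1) → Tm 0) :
    (M.subst (liftSub fun i => σ i.succ)).inst (σ 0) = M.subst σ := by
  rw [Tm.inst, Tm.subst_subst]
  congr 1
  funext i
  refine Fin.cases ?_ (fun i => ?_) i
  · simp [liftSub, Tm.subst]
  · simp [liftSub, Tm.subst_rename, Tm.subst_closed]

/-! ### The semantics is compositional -/

theorem BigStep.le_sem {M : Tm 0} {D : Tm 1 →₀ ℝ≥0∞} (h : BigStep M D) (V : Tm 1) :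
    D V ≤ sem M V :=
  le_iSup (fun D : {D : Tm 1 →₀ ℝ≥0∞ // BigStep M D} => D.1 V) ⟨D, h⟩

instance (M : Tm 0) : Nonempty {D : Tm 1 →₀ ℝ≥0∞ // BigStep M D} := ⟨⟨0, .bt M⟩⟩

/-- The integral of a function against the semantics is the supremum of its integrals against
the approximations. -/
theorem tsum_sem_mul_le_iff {M : Tm 0} {f : Tm 1 → ℝ≥0∞} {c : ℝ≥0∞} :
    ∑' V, sem M V * f V ≤ c ↔ ∀ D, BigStep M D → ∑' V, D V * f V ≤ c := by
  refine ⟨fun h D hD => (ENNReal.tsum_le_tsum fun V => ?_).trans h, fun h => ?_⟩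
  · exact mul_le_mul' (hD.le_sem V) le_rfl
  rw [ENNReal.tsum_eq_iSup_sum]
  refine iSup_le fun s => ?_
  simp only [sem, ENNReal.iSup_mul]
  rw [ENNReal.finsetSum_iSup]
  · exact iSup_le fun D => (ENNReal.sum_le_tsum s).trans (h D.1 D.2)
  · intro D₁ D₂
    obtain ⟨D, hD, h1, h2⟩ := D₁.2.directed D₂.2
    exact ⟨⟨D, hD⟩, fun V => ⟨mul_le_mul' (h1 V) le_rfl, mul_le_mul' (h2 V) le_rfl⟩⟩

theorem Finsupp.tsum_mul_eq_sum {α : Type*} (D : α →₀ ℝ≥0∞) (f : α → ℝ≥0∞) :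
    ∑' a, D a * f a = ∑ a ∈ D.support, D a * f a :=
  tsum_eq_sum fun a ha => by simp [Finsupp.notMem_support_iff.1 ha]

theorem sem_app (M N : Tm 0) (V : Tm 1) :
    sem (.app M N) V = ∑' P, sem M P * sem (P.inst N) V := by
  refine le_antisymm (iSup_le ?_) (tsum_sem_mul_le_iff.2 fun D hD => ?_)
  · rintro ⟨D', h⟩
    cases h with
    | bt => simp
    | ba _ _ D E hD hE =>
      simp only [Finsupp.coe_finsetSum, Finset.sum_apply, Finsupp.smul_apply, smul_eq_mul]
      refine (Finset.sum_le_sum fun P hP => ?_).trans (ENNReal.sum_le_tsum D.support)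
      exact mul_le_mul' (hD.le_sem P) ((hE P hP).le_sem V)
  · rw [Finsupp.tsum_mul_eq_sum]
    -- Indexing all these suprema by one family, which picks an approximation for every `P` at once,
    -- gives them a common directed index set, so that the finite sum over `D.support` commutes with
    -- the supremum.
    have key : ∀ P, D P * sem (P.inst N) V =
        ⨆ E : ∀ P : Tm 1, {E : Tm 1 →₀ ℝ≥0∞ // BigStep (P.inst N) E}, D P * (E P).1 V := by
      intro P
      rw [sem, ENNReal.mul_iSup]
      exact ((Function.surjective_eval (β := fun P : Tm 1 =>
        {E : Tm 1 →₀ ℝ≥0∞ // BigStep (P.inst N) E}) P).iSup_comp fun E => D P * E.1 V).symm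
    simp only [key]
    rw [ENNReal.finsetSum_iSup]
    · refine iSup_le fun E => ?_
      refine le_trans (le_of_eq ?_)
        ((BigStep.ba M N D (fun P => (E P).1) hD fun P _ => (E P).2).le_sem V)
      simp only [Finsupp.coe_finsetSum, Finset.sum_apply, Finsupp.smul_apply, smul_eq_mul]
    · intro E₁ E₂
      choose E hE h1 h2 using fun P => (E₁ P).2.directed (E₂ P).2
      exact ⟨fun P => ⟨E P, hE P⟩, fun P =>
        ⟨mul_le_mul' le_rfl (h1 P V), mul_le_mul' le_rfl (h2 P V)⟩⟩

theorem sem_lam_self (P : Tm 1) : sem (.lam P) P = 1 := by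
  refine le_antisymm ((ENNReal.le_tsum P).trans (sem_mass_le_one _)) ?_
  simpa using (BigStep.bv P).le_sem P

theorem sem_lam_of_ne {P V : Tm 1} (h : V ≠ P) : sem (.lam P) V = 0 := by
  refine le_antisymm (iSup_le ?_) bot_le
  rintro ⟨D, hD⟩
  cases hD with
  | bt => simp
  | bv => simp [h.symm]

theorem tsum_sem_lam_mul (P : Tm 1) (f : Tm 1 → ℝ≥0∞) : ∑' V, sem (.lam P) V * f V = f P := by
  rw [tsum_eq_single P fun V h => by rw [sem_lam_of_ne h, zero_mul], sem_lam_self, one_mul]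

theorem sem_choice (M N : Tm 0) (V : Tm 1) :
    sem (.choice M N) V = 2⁻¹ * sem M V + 2⁻¹ * sem N V := by
  refine le_antisymm (iSup_le ?_) ?_
  · rintro ⟨D', h⟩
    cases h with
    | bt => simp
    | bs _ _ D E hD hE =>
      simp only [Finsupp.add_apply, Finsupp.smul_apply, smul_eq_mul]
      exact add_le_add (mul_le_mul' le_rfl (hD.le_sem V)) (mul_le_mul' le_rfl (hE.le_sem V))
  · rw [sem, sem, ENNReal.mul_iSup, ENNReal.mul_iSup]
    refine ENNReal.iSup_add_iSup_le fun D E => ?_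
    simpa using (BigStep.bs M N D.1 E.1 D.2 E.2).le_sem V

/-! ### The probability of convergence on a stack of arguments -/

/-- The probability that `M`, applied to the arguments in the list, converges. -/
noncomputable def mass : Tm 0 → List (Tm 0) → ℝ≥0∞
  | M, [] => ∑' V, sem M V
  | M, N :: S => ∑' V, sem M V * mass (V.inst N) S

theorem mass_lam_nil (P : Tm 1) : mass (.lam P) [] = 1 := by
  simpa [mass] using tsum_sem_lam_mul P fun _ => 1

theorem mass_lam_cons (P : Tm 1) (N : Tm 0) (S : List (Tm 0)) :
    mass (.lam P) (N :: S) = mass (P.inst N) S :=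
  tsum_sem_lam_mul P fun V => mass (V.inst N) S

/-- A stack sees a term only as the mixture of its values. This carries the equations for `sem` over
to `mass`. -/
theorem mass_eq_tsum (M : Tm 0) (S : List (Tm 0)) :
    mass M S = ∑' V, sem M V * mass (.lam V) S := by
  cases S with
  | nil => simp only [mass_lam_nil, mul_one]; rw [mass]
  | cons N S => simp only [mass_lam_cons]; rw [mass]

theorem mass_app (M N : Tm 0) (S : List (Tm 0)) : mass (.app M N) S = mass M (N :: S) := by
  rw [mass_eq_tsum, mass]
  simp only [sem_app, ← ENNReal.tsum_mul_right]
  rw [ENNReal.tsum_comm]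
  refine tsum_congr fun P => ?_
  simp only [mul_assoc]
  rw [ENNReal.tsum_mul_left, ← mass_eq_tsum]

theorem mass_choice (M N : Tm 0) (S : List (Tm 0)) :
    mass (.choice M N) S = 2⁻¹ * mass M S + 2⁻¹ * mass N S := by
  rw [mass_eq_tsum, mass_eq_tsum M, mass_eq_tsum N]
  simp only [sem_choice, add_mul, mul_assoc]
  rw [ENNReal.tsum_add, ENNReal.tsum_mul_left, ENNReal.tsum_mul_left]

/-- The probability that `M`, applied to the arguments in the list, converges in fewer than `n`
steps. -/
noncomputable def massWithin : ℕ → Tm 0 → List (Tm 0) → ℝ≥0∞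
  | 0, _, _ => 0
  | _ + 1, .lam _, [] => 1
  | n + 1, .lam P, N :: S => massWithin n (P.inst N) S
  | n + 1, .app M N, S => massWithin n M (N :: S)
  | n + 1, .choice M N, S => 2⁻¹ * massWithin n M S + 2⁻¹ * massWithin n N S

theorem massWithin_le_succ (n : ℕ) (M : Tm 0) (S : List (Tm 0)) :
    massWithin n M S ≤ massWithin (n + 1) M S := by
  induction n generalizing M S with
  | zero => simp [massWithin]
  | succ n ih =>
    cases M with
    | var i => exact i.elim0
    | lam P =>
      cases S with
      | nil => simp [massWithin]
      | cons N S => simpa only [massWithin] using ih _ _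
    | app M N => simpa only [massWithin] using ih _ _
    | choice M N =>
      simp only [massWithin]
      gcongr <;> apply ih

theorem massWithin_mono (M : Tm 0) (S : List (Tm 0)) : Monotone fun n => massWithin n M S :=
  monotone_nat_of_le_succ fun n => massWithin_le_succ n M S

theorem iSup_massWithin_lam_nil (P : Tm 1) : ⨆ n, massWithin n (.lam P) [] = 1 := by
  rw [← (massWithin_mono _ _).iSup_nat_add 1]
  simp [massWithin]

theorem iSup_massWithin_lam_cons (P : Tm 1) (N : Tm 0) (S : List (Tm 0)) :
    ⨆ n, massWithin n (.lam P) (N :: S) = ⨆ n, massWithin n (P.inst N) S := by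
  rw [← (massWithin_mono _ _).iSup_nat_add 1]
  simp only [massWithin]

theorem iSup_massWithin_app (M N : Tm 0) (S : List (Tm 0)) :
    ⨆ n, massWithin n (.app M N) S = ⨆ n, massWithin n M (N :: S) := by
  rw [← (massWithin_mono _ _).iSup_nat_add 1]
  simp only [massWithin]

theorem iSup_massWithin_choice (M N : Tm 0) (S : List (Tm 0)) :
    ⨆ n, massWithin n (.choice M N) S =
      2⁻¹ * (⨆ n, massWithin n M S) + 2⁻¹ * (⨆ n, massWithin n N S) := by
  rw [← (massWithin_mono _ _).iSup_nat_add 1]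
  simp only [massWithin, ENNReal.mul_iSup]
  refine (ENNReal.iSup_add_iSup_of_monotone ?_ ?_).symm <;>
    exact fun m n h => mul_le_mul' le_rfl (massWithin_mono _ _ h)

/-- Compares the big-step rules with the stack machine counted by `massWithin`. The stack must stay
general in the induction, because the rule for applications pushes an argument. -/
theorem BigStep.tsum_mul_le_iSup_massWithin {M : Tm 0} {D : Tm 1 →₀ ℝ≥0∞} (h : BigStep M D)
    (S : List (Tm 0)) :
    ∑' V, D V * (⨆ n, massWithin n (.lam V) S) ≤ ⨆ n, massWithin n M S := by
  induction h generalizing S with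
  | bt M => simp
  | bv P =>
    rw [tsum_eq_single P fun V hV => by simp [hV.symm]]
    simp
  | ba M N D E _ _ ih ih' =>
    simp only [Finsupp.coe_finsetSum, Finset.sum_apply, Finsupp.smul_apply, smul_eq_mul,
      Finset.sum_mul, mul_assoc]
    rw [Summable.tsum_finsetSum (fun _ _ => ENNReal.summable), iSup_massWithin_app]
    refine le_trans (Finset.sum_le_sum fun P hP => ?_)
      ((Finsupp.tsum_mul_eq_sum D _).symm.le.trans (ih (N :: S)))
    rw [ENNReal.tsum_mul_left, iSup_massWithin_lam_cons]
    exact mul_le_mul' le_rfl (ih' P hP S)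
  | bs M N D E _ _ ih ih' =>
    simp only [Finsupp.add_apply, Finsupp.smul_apply, smul_eq_mul, add_mul, mul_assoc]
    rw [ENNReal.tsum_add, ENNReal.tsum_mul_left, ENNReal.tsum_mul_left, iSup_massWithin_choice]
    exact add_le_add (mul_le_mul' le_rfl (ih S)) (mul_le_mul' le_rfl (ih' S))

/-- Adequacy of the step count: a bound on every `massWithin n` bounds `mass`. Only this inequality
is needed. -/
theorem mass_le_iSup_massWithin (M : Tm 0) (S : List (Tm 0)) :
    mass M S ≤ ⨆ n, massWithin n M S := by
  induction S generalizing M with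
  | nil =>
    rw [mass_eq_tsum]
    refine tsum_sem_mul_le_iff.2 fun D hD => le_trans (ENNReal.tsum_le_tsum fun V => ?_)
      (hD.tsum_mul_le_iSup_massWithin [])
    rw [mass_lam_nil, iSup_massWithin_lam_nil]
  | cons N S ih =>
    rw [mass_eq_tsum]
    refine tsum_sem_mul_le_iff.2 fun D hD => le_trans (ENNReal.tsum_le_tsum fun V => ?_)
      (hD.tsum_mul_le_iSup_massWithin (N :: S))
    rw [mass_lam_cons, iSup_massWithin_lam_cons]
    exact mul_le_mul' le_rfl (ih _)

/-! ### Applicative equivalence and its congruence closure -/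

/-- Equal probability of convergence under all closing substitutions and lists of arguments. -/
def MassEquiv {n : ℕ} (M N : Tm n) : Prop :=
  ∀ (σ : Fin n → Tm 0) (S : List (Tm 0)), mass (M.subst σ) S = mass (N.subst σ) S

theorem MassEquiv.symm {n : ℕ} {M N : Tm n} (h : MassEquiv M N) : MassEquiv N M :=
  fun σ S => (h σ S).symm

theorem massEquiv_closed_iff {M N : Tm 0} : MassEquiv M N ↔ ∀ S, mass M S = mass N S := by
  simp [MassEquiv, Tm.subst_closed]

theorem MassEquiv.subst {m n : ℕ} {M N : Tm m} (h : MassEquiv M N) (σ : Fin m → Tm n) :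
    MassEquiv (M.subst σ) (N.subst σ) := fun τ S => by
  simpa only [Tm.subst_subst] using h _ S

/-- The closure of applicative equivalence under the term constructors, and under composition with
applicative equivalence on the right. -/
inductive MassClosure : {n : ℕ} → Tm n → Tm n → Prop
  | trans {n : ℕ} {M N L : Tm n} : MassClosure M N → MassEquiv N L → MassClosure M L
  | var {n : ℕ} (i : Fin n) : MassClosure (.var i) (.var i)
  | lam {n : ℕ} {M N : Tm (n + 1)} : MassClosure M N → MassClosure (.lam M) (.lam N)
  | app {n : ℕ} {M N M' N' : Tm n} : MassClosure M N → MassClosure M' N' →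
      MassClosure (.app M M') (.app N N')
  | choice {n : ℕ} {M N M' N' : Tm n} : MassClosure M N → MassClosure M' N' →
      MassClosure (.choice M M') (.choice N N')

namespace MassClosure

theorem refl {n : ℕ} (M : Tm n) : MassClosure M M := by
  induction M with
  | var i => exact .var i
  | lam M ih => exact .lam ih
  | app M N ih ih' => exact .app ih ih'
  | choice M N ih ih' => exact .choice ih ih'

theorem of_massEquiv {n : ℕ} {M N : Tm n} (h : MassEquiv M N) : MassClosure M N :=
  (refl M).trans h

theorem rename {m n : ℕ} {M N : Tm m} (h : MassClosure M N) (ρ : Fin m → Fin n) :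
    MassClosure (M.rename ρ) (N.rename ρ) := by
  induction h generalizing n with
  | trans _ h ih =>
    refine (ih ρ).trans ?_
    rw [Tm.rename_eq_subst, Tm.rename_eq_subst]
    exact h.subst _
  | var i => exact .var _
  | lam _ ih => exact .lam (ih _)
  | app _ _ ih ih' => exact .app (ih _) (ih' _)
  | choice _ _ ih ih' => exact .choice (ih _) (ih' _)

theorem subst {m n : ℕ} {M N : Tm m} (h : MassClosure M N) {σ τ : Fin m → Tm n}
    (hσ : ∀ i, MassClosure (σ i) (τ i)) : MassClosure (M.subst σ) (N.subst τ) := by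
  induction h generalizing n with
  | trans _ h ih => exact (ih hσ).trans (h.subst τ)
  | var i => exact hσ i
  | lam _ ih =>
    refine .lam (ih fun i => ?_)
    refine Fin.cases ?_ (fun i => ?_) i
    · exact .var 0
    · simpa [liftSub] using (hσ i).rename Fin.succ
  | app _ _ ih ih' => exact .app (ih hσ) (ih' hσ)
  | choice _ _ ih ih' => exact .choice (ih hσ) (ih' hσ)

/-- Related terms applied to related arguments: the first converges at most as often as the
second. -/
theorem massWithin_le {n : ℕ} : ∀ {M N : Tm 0} {S T : List (Tm 0)}, MassClosure M N →
    List.Forall₂ MassClosure S T → massWithin n M S ≤ mass N T := by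
  induction n with
  | zero => intros; simp [massWithin]
  | succ n ihn =>
    -- The scope is made a variable `k` so that induction on the derivation of `MassClosure` is
    -- possible.
    suffices H : ∀ {k : ℕ} {M N : Tm k}, MassClosure M N → ∀ hk : k = 0,
        ∀ {S T : List (Tm 0)}, List.Forall₂ MassClosure S T →
        massWithin (n + 1) (hk ▸ M) S ≤ mass (hk ▸ N) T from
      fun {_ _ _ _} h hS => H h rfl hS
    intro k M N h
    induction h with
    -- No step is consumed here, hence the inner induction on the derivation. The right side counts
    -- all runs, so it does not matter that `MassEquiv` ignores their length.
    | trans _ h ih =>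
      rintro rfl S T hS
      exact (ih rfl hS).trans_eq (massEquiv_closed_iff.1 h T)
    | var i => rintro rfl; exact i.elim0
    | lam h _ =>
      rintro rfl S T hS
      cases hS with
      | nil => simp [massWithin, mass_lam_nil]
      | cons hA hS =>
        simp only [massWithin, mass_lam_cons]
        -- The β-step lowers the bound, and substitutivity keeps the contracted bodies related.
        exact ihn (h.subst fun _ => hA) hS
    | app h h' _ _ =>
      rintro rfl S T hS
      simp only [massWithin, mass_app]
      exact ihn h (.cons h' hS)
    | choice h h' _ _ =>
      rintro rfl S T hS
      simp only [massWithin, mass_choice]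
      exact add_le_add (mul_le_mul' le_rfl (ihn h hS)) (mul_le_mul' le_rfl (ihn h' hS))

theorem mass_le {M N : Tm 0} {S T : List (Tm 0)} (h : MassClosure M N)
    (hS : List.Forall₂ MassClosure S T) : mass M S ≤ mass N T :=
  (mass_le_iSup_massWithin M S).trans (iSup_le fun _ => massWithin_le h hS)

theorem fill {m n : ℕ} {M N : Tm m} (h : MassClosure M N) (C : Ctx m n) :
    MassClosure (C.fill M) (C.fill N) := by
  induction C with
  | hole ρ => exact h.rename ρ
  | lam C ih => exact .lam ih
  | appL C M ih => exact .app ih (refl M)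
  | appR M C ih => exact .app (refl M) ih
  | choiceL C M ih => exact .choice ih (refl M)
  | choiceR M C ih => exact .choice (refl M) ih

theorem of_ctxClosure {n : ℕ} {M N : Tm n} (h : CtxClosure MassEquiv M N) : MassClosure M N := by
  induction h with
  | hole h => exact (of_massEquiv h).rename _
  | var i => exact .var i
  | lam _ ih => exact .lam ih
  | app _ _ ih ih' => exact .app ih ih'
  | choice _ _ ih ih' => exact .choice ih ih'

end MassClosure

theorem CtxClosure.refl (R : Tm 0 → Tm 0 → Prop) {n : ℕ} (M : Tm n) : CtxClosure R M M := by
  induction M with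
  | var i => exact .var i
  | lam M ih => exact .lam ih
  | app M N ih ih' => exact .app ih ih'
  | choice M N ih ih' => exact .choice ih ih'

theorem CtxClosure.symm {R : Tm 0 → Tm 0 → Prop} (hR : ∀ M N, R M N → R N M) {n : ℕ} {M N : Tm n}
    (h : CtxClosure R M N) : CtxClosure R N M := by
  induction h with
  | hole h => exact .hole (hR _ _ h)
  | var i => exact .var i
  | lam _ ih => exact .lam ih
  | app _ _ ih ih' => exact .app ih ih'
  | choice _ _ ih ih' => exact .choice ih ih'

/-- The form of congruence used in the value clauses of bisimulation. `MassClosure` is not symmetric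
by construction, so the reverse inequality comes from the symmetry of `CtxClosure`. -/
theorem mass_lam_cons_eq_of_ctxClosure {M N : Tm 0} (h : CtxClosure MassEquiv M N) (P : Tm 1)
    (S : List (Tm 0)) : mass (.lam P) (M :: S) = mass (.lam P) (N :: S) := by
  have key : ∀ {M N : Tm 0}, CtxClosure MassEquiv M N →
      mass (.lam P) (M :: S) ≤ mass (.lam P) (N :: S) := fun h =>
    MassClosure.mass_le (.refl _)
      (.cons (.of_ctxClosure h) (List.forall₂_same.2 fun L _ => .refl L))
  exact le_antisymm (key h) (key (h.symm fun _ _ => MassEquiv.symm))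

/-! ### Context equivalence is applicative equivalence -/

theorem convergesTo_iff {M : Tm 0} {p : ℝ≥0∞} : ConvergesTo M p ↔ mass M [] = p := Iff.rfl

theorem ctxEquiv_iff_mass {n : ℕ} {M N : Tm n} :
    CtxEquiv M N ↔ ∀ C : Ctx n 0, mass (C.fill M) [] = mass (C.fill N) [] := by
  simp only [CtxEquiv, CtxLe, convergesTo_iff]
  refine ⟨fun ⟨h, h'⟩ C => ?_, fun h => ⟨fun C p hp => ?_, fun C p hp => ?_⟩⟩
  · obtain ⟨_, rfl, h1⟩ := h C _ rfl
    obtain ⟨_, rfl, h2⟩ := h' C _ rfl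
    exact le_antisymm h1 h2
  · exact ⟨p, (h C).symm.trans hp, le_rfl⟩
  · exact ⟨p, (h C).trans hp, le_rfl⟩

theorem exists_ctx_mass_fill_eq_subst {m n : ℕ} (C : Ctx m n) (σ : Fin n → Tm 0) :
    ∃ C' : Ctx m 0, ∀ M S, mass (C'.fill M) S = mass ((C.fill M).subst σ) S := by
  induction n with
  | zero => exact ⟨C, fun M S => by rw [Tm.subst_closed]⟩
  | succ n ih =>
    -- The first variable is bound by a β-redex whose argument is `σ 0`. Being closed, this argument
    -- is untouched by the remaining substitution.
    obtain ⟨C', h⟩ := ih (.appL (.lam C) (σ 0).weaken) fun i => σ i.succ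
    refine ⟨C', fun M S => ?_⟩
    rw [h, Ctx.fill, Ctx.fill, Tm.subst, Tm.subst, mass_app, mass_lam_cons, Tm.weaken_subst,
      Tm.inst_subst_liftSub]

theorem exists_ctx_mass_fill_nil {m : ℕ} (C : Ctx m 0) (S : List (Tm 0)) :
    ∃ C' : Ctx m 0, ∀ M, mass (C'.fill M) [] = mass (C.fill M) S := by
  induction S generalizing C with
  | nil => exact ⟨C, fun _ => rfl⟩
  | cons N S ih =>
    obtain ⟨C', h⟩ := ih (.appL C N)
    exact ⟨C', fun M => by rw [h, Ctx.fill, mass_app]⟩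

theorem massEquiv_iff_ctxEquiv {n : ℕ} {M N : Tm n} : MassEquiv M N ↔ CtxEquiv M N := by
  rw [ctxEquiv_iff_mass]
  refine ⟨fun h C => ?_, fun h σ S => ?_⟩
  · exact le_antisymm (((MassClosure.of_massEquiv h).fill C).mass_le .nil)
      (((MassClosure.of_massEquiv h.symm).fill C).mass_le .nil)
  · obtain ⟨C, hC⟩ := exists_ctx_mass_fill_eq_subst (.hole (.refl (Fin n))) σ
    obtain ⟨C', hC'⟩ := exists_ctx_mass_fill_nil C S
    have key : ∀ L : Tm n, mass (C'.fill L) [] = mass (L.subst σ) S := fun L => by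
      rw [hC', hC, Ctx.fill, Tm.subst_rename]
      rfl
    rw [← key, ← key, h]

/-! ### Reduction of terms with formal sums -/

/-- The probability that `E`, applied to the arguments in the list, converges. -/
noncomputable def FTm.mass : FTm → List (Tm 0) → ℝ≥0∞
  | .app E M, S => E.mass (M :: S)
  | .sum H, S => ∑' i, H.wt i * ProbLam.mass (H.term i) S
  | .choice M N, S => ProbLam.mass (.choice M N) S
  | .lam P, S => ProbLam.mass (.lam P) S

theorem Tm.mass_toFTm : ∀ (M : Tm 0) (S : List (Tm 0)), M.toFTm.mass S = mass M S
  | .lam P, S => by rw [Tm.toFTm, FTm.mass]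
  | .app M N, S => by rw [Tm.toFTm, FTm.mass, Tm.mass_toFTm M, mass_app]
  | .choice M N, S => by rw [Tm.toFTm, FTm.mass]

theorem FTm.mass_apps (E : FTm) (Ms S : List (Tm 0)) :
    (E.apps Ms).mass S = E.mass (Ms ++ S) := by
  induction Ms generalizing E with
  | nil => rfl
  | cons M Ms ih => exact ih (.app E M)

theorem FSum.mass_nil_of_isValue {Z : FSum} (hZ : Z.IsValue) : (FTm.sum Z).mass [] = Z.prob := by
  refine tsum_congr fun i => ?_
  obtain ⟨P, hP⟩ := hZ i
  rw [hP, mass_lam_nil, mul_one]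

theorem FSum.mass_bullet {Z : FSum} (hZ : Z.IsValue) (M : Tm 0) (S : List (Tm 0)) :
    (FTm.sum (Z.bullet M)).mass S = (FTm.sum Z).mass (M :: S) := by
  refine tsum_congr fun i => ?_
  obtain ⟨P, hP⟩ := hZ i
  simp only [FSum.bullet]
  rw [hP, mass_lam_cons, FSum.contract]

/-- The only rule that does real work, `spc`, is `mass_eq_tsum` applied to each summand. -/
theorem Step.mass_eq {E F : FTm} (h : Step E F) (S : List (Tm 0)) : E.mass S = F.mass S := by
  induction h generalizing S with
  | ss M N => simp [FTm.mass, mass_choice, FSum.half]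
  | sl P => simp [FTm.mass, FSum.single]
  | spc H _ =>
    simp only [FTm.mass, FSum.bind]
    rw [ENNReal.tsum_sigma (fun i V => (FSum.ofSem (H.term i)).wt V * H.wt i *
      mass ((FSum.ofSem (H.term i)).term V) S)]
    refine tsum_congr fun i => ?_
    rw [mass_eq_tsum, ← ENNReal.tsum_mul_left]
    refine tsum_congr fun V => ?_
    simp only [FSum.ofSem]
    ring
  | sp Z M hZ => exact (FSum.mass_bullet hZ M S).symm
  | sa E F M _ ih => exact ih (M :: S)

theorem Steps.mass_eq {E F : FTm} (h : Steps E F) (S : List (Tm 0)) : E.mass S = F.mass S := by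
  induction h with
  | refl => rfl
  | tail _ h ih => exact ih.trans (h.mass_eq S)

/-- One step suffices, since `spc` replaces every summand by its whole semantics; divergence only
loses weight and never blocks reduction. -/
theorem FSum.exists_steps_value (H : FSum) :
    ∃ Z : FSum, Z.IsValue ∧ Steps (.sum H) (.sum Z) := by
  by_cases h : H.IsValue
  · exact ⟨H, h, .refl⟩
  · exact ⟨H.bind FSum.ofSem, fun x => ⟨x.2, rfl⟩, .single (.spc H h)⟩

theorem FTm.exists_steps_value (E : FTm) : ∃ Z : FSum, Z.IsValue ∧ Steps E (.sum Z) := by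
  induction E with
  | app E M ih =>
    obtain ⟨Z, hZ, h⟩ := ih
    obtain ⟨Y, hY, h'⟩ := (Z.bullet M).exists_steps_value
    refine ⟨Y, hY, .trans (Relation.ReflTransGen.lift (FTm.app · M) (fun E F => Step.sa E F M) _ _ h)
      (.head (.sp Z M hZ) h')⟩
  | sum H => exact H.exists_steps_value
  | choice M N =>
    obtain ⟨Z, hZ, h⟩ := (FSum.half M N).exists_steps_value
    exact ⟨Z, hZ, .head (.ss M N) h⟩
  | lam P => exact ⟨_, fun _ => ⟨P, rfl⟩, .single (.sl P)⟩

theorem FTm.convergesTo_iff {E : FTm} {p : ℝ≥0∞} : E.ConvergesTo p ↔ E.mass [] = p := by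
  constructor
  · rintro ⟨Z, hZ, h, rfl⟩
    rw [h.mass_eq, FSum.mass_nil_of_isValue hZ]
  · rintro rfl
    obtain ⟨Z, hZ, h⟩ := E.exists_steps_value
    exact ⟨Z, hZ, h, by rw [h.mass_eq, FSum.mass_nil_of_isValue hZ]⟩

theorem ctxEquivFS_iff_ctxEquiv {n : ℕ} {M N : Tm n} : CtxEquivFS M N ↔ CtxEquiv M N := by
  rw [ctxEquiv_iff_mass]
  simp only [CtxEquivFS, FTm.convergesTo_iff, Tm.mass_toFTm]
  exact forall_congr' fun C => ⟨fun h => ((h _).1 rfl).symm, fun h p => by rw [h]⟩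

theorem evalCtxEquiv_iff_mass {E F : FTm} : EvalCtxEquiv E F ↔ ∀ S, E.mass S = F.mass S := by
  simp only [EvalCtxEquiv, FTm.convergesTo_iff, FTm.mass_apps, List.append_nil]
  exact forall_congr' fun S => ⟨fun h => ((h _).1 rfl).symm, fun h p => by rw [h]⟩

/-! ### Coupled logical bisimilarity -/

theorem IsCoupledLogicalBisimulation.steps {R₁ : Tm 0 → Tm 0 → Prop} {R₂ : FTm → FTm → Prop}
    (h : IsCoupledLogicalBisimulation R₁ R₂) {E F D : FTm} (hEF : R₂ E F) (hD : Steps E D) :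
    ∃ G, Steps F G ∧ R₂ D G := by
  induction hD with
  | refl => exact ⟨F, .refl, hEF⟩
  | tail _ hs ih =>
    obtain ⟨G, hG, hR⟩ := ih
    obtain ⟨G', hG', hR'⟩ := h.step _ _ hR _ hs
    exact ⟨G', .trans hG hG', hR'⟩

/-- The forward clauses suffice: they match a value of `E` with a value of `F` of the same weight,
and the two stay related after each argument. -/
theorem IsCoupledLogicalBisimulation.mass_eq {R₁ : Tm 0 → Tm 0 → Prop} {R₂ : FTm → FTm → Prop}
    (h : IsCoupledLogicalBisimulation R₁ R₂) {E F : FTm} (hEF : R₂ E F) (S : List (Tm 0)) :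
    E.mass S = F.mass S := by
  obtain ⟨Z, hZ, hEZ⟩ := E.exists_steps_value
  obtain ⟨G, hFG, hR⟩ := h.steps hEF hEZ
  obtain ⟨Y, hY, hGY, hp, hb⟩ := h.value Z G hR hZ
  rw [hEZ.mass_eq, hFG.mass_eq, hGY.mass_eq]
  induction S generalizing E F Z G Y with
  | nil => rw [FSum.mass_nil_of_isValue hZ, FSum.mass_nil_of_isValue hY, hp]
  | cons N S ih =>
    rw [← FSum.mass_bullet hZ, ← FSum.mass_bullet hY]
    -- Both sides receive the same argument, which the context closure always relates to itself.
    have hR' := hb N N (.refl _ N)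
    obtain ⟨Z', hZ', hEZ'⟩ := (FTm.sum (Z.bullet N)).exists_steps_value
    obtain ⟨G', hFG', hR''⟩ := h.steps hR' hEZ'
    obtain ⟨Y', hY', hGY', hp', hb'⟩ := h.value Z' G' hR'' hZ'
    rw [hEZ'.mass_eq, hFG'.mass_eq, hGY'.mass_eq]
    exact ih hR' Z' hZ' hEZ' G' hFG' hR'' Y' hY' hGY' hp' hb'

/-- The function is changed first, with `M` kept on the stack; then `M` is replaced by `N` below
each abstraction of `Y`. -/
theorem FSum.mass_bullet_congr {Z Y : FSum} (hZ : Z.IsValue) (hY : Y.IsValue)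
    (h : ∀ S, (FTm.sum Z).mass S = (FTm.sum Y).mass S) {M N : Tm 0}
    (hMN : CtxClosure MassEquiv M N) (S : List (Tm 0)) :
    (FTm.sum (Z.bullet M)).mass S = (FTm.sum (Y.bullet N)).mass S := by
  rw [FSum.mass_bullet hZ, FSum.mass_bullet hY, h]
  refine tsum_congr fun i => ?_
  obtain ⟨P, hP⟩ := hY i
  rw [hP, mass_lam_cons_eq_of_ctxClosure hMN]

/-- Reduction preserves mass, so a step on one side is answered by no step on the other. A value is
answered by any value that the other side reaches. -/
theorem isCoupledLogicalBisimulation_mass :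
    IsCoupledLogicalBisimulation MassEquiv fun E F => ∀ S, E.mass S = F.mass S where
  coupled M N h S := by rw [Tm.mass_toFTm, Tm.mass_toFTm, massEquiv_closed_iff.1 h]
  step E F h D hD := ⟨F, .refl, fun S => (hD.mass_eq S).symm.trans (h S)⟩
  step_conv E F h G hG := ⟨E, .refl, fun S => (h S).trans (hG.mass_eq S)⟩
  value Z F h hZ := by
    obtain ⟨Y, hY, hFY⟩ := F.exists_steps_value
    have h' : ∀ S, (FTm.sum Z).mass S = (FTm.sum Y).mass S := fun S =>
      (h S).trans (hFY.mass_eq S)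
    refine ⟨Y, hY, hFY, ?_, fun M N => FSum.mass_bullet_congr hZ hY h'⟩
    rw [← FSum.mass_nil_of_isValue hZ, ← FSum.mass_nil_of_isValue hY, h']
  value_conv E Y h hY := by
    obtain ⟨Z, hZ, hEZ⟩ := E.exists_steps_value
    have h' : ∀ S, (FTm.sum Z).mass S = (FTm.sum Y).mass S := fun S =>
      (hEZ.mass_eq S).symm.trans (h S)
    refine ⟨Z, hZ, hEZ, ?_, fun M N => FSum.mass_bullet_congr hZ hY h'⟩
    rw [← FSum.mass_nil_of_isValue hZ, ← FSum.mass_nil_of_isValue hY, h']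

theorem bisimilar₁_iff {M N : Tm 0} : Bisimilar₁ M N ↔ ∀ S, mass M S = mass N S := by
  constructor
  · rintro ⟨R₁, R₂, h, hMN⟩ S
    simpa only [Tm.mass_toFTm] using h.mass_eq (h.coupled M N hMN) S
  · exact fun h => ⟨_, _, isCoupledLogicalBisimulation_mass, massEquiv_closed_iff.2 h⟩

theorem bisimilar₂_iff {E F : FTm} : Bisimilar₂ E F ↔ EvalCtxEquiv E F := by
  rw [evalCtxEquiv_iff_mass]
  constructor
  · rintro ⟨R₁, R₂, h, hEF⟩
    exact h.mass_eq hEF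
  · exact fun h => ⟨_, _, isCoupledLogicalBisimulation_mass, h⟩

theorem bisimilar₁Open_iff {n : ℕ} {M N : Tm n} : Bisimilar₁Open M N ↔ CtxEquivFS M N := by
  rw [ctxEquivFS_iff_ctxEquiv, ← massEquiv_iff_ctxEquiv]
  simp only [Bisimilar₁Open, bisimilar₁_iff, MassEquiv]

end ProbLam

theorem corollaryc :
    (∀ M N : ProbLam.Tm 0,
      (ProbLam.Bisimilar₁ M N ↔ ProbLam.CtxEquivFS M N) ∧
      (ProbLam.CtxEquivFS M N ↔ ProbLam.CtxEquiv M N)) ∧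
    (∀ E F : ProbLam.FTm, ProbLam.Bisimilar₂ E F ↔ ProbLam.EvalCtxEquiv E F) ∧
    (∀ (n : ℕ) (M N : ProbLam.Tm n),
      (ProbLam.Bisimilar₁Open M N ↔ ProbLam.CtxEquivFS M N) ∧
      (ProbLam.CtxEquivFS M N ↔ ProbLam.CtxEquiv M N)) := by
  refine ⟨fun M N => ⟨?_, ProbLam.ctxEquivFS_iff_ctxEquiv⟩, fun E F => ProbLam.bisimilar₂_iff,
    fun n M N => ⟨ProbLam.bisimilar₁Open_iff, ProbLam.ctxEquivFS_iff_ctxEquiv⟩⟩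
  rw [ProbLam.ctxEquivFS_iff_ctxEquiv, ← ProbLam.massEquiv_iff_ctxEquiv,
    ProbLam.massEquiv_closed_iff, ProbLam.bisimilar₁_iff]
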